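/- Let $G_1,G_2$ be finite abelian groups with dual groups (groups of complex characters) $\widehat G_1,\widehat G_2$, and identify $\widehat{G_1\times G_2}$ with $\widehat G_1\times\widehat G_2$. For a finite abelian group $G$ and $h:G\to\mathbb C$ put $\widehat h(\chi)=\frac1{|G|}\sum_{x\in G}h(x)\overline{\chi(x)}$; a set $S\subseteq\widehat G$ is a Fourier support of $h$ if it contains every $\chi$ with $\widehat h(\chi)\neq0$. A function $f:G\to\mathbb R$ has an FSOS (Fourier sum of squares) certificate with Fourier support $T\subseteq\widehat G$ if $f=\sum_{i=1}^n|h_i|^2$ for finitely many functions $h_i:G\to\mathbb C$ that all have $T$ as a Fourier support; the FSOS sparsity of $f$ is the least cardinality of such a $T$. For $S\subseteq\widehat G$, the Cayley graph $\operatorname{Cay}(\widehat G,S)$ has vertex set $\widehat G$, distinct vertices $\chi,\chi'$ being adjacent if $\chi'\in S\chi$ or $\chi\in S\chi'$. A graph is chordal if every cycle of length at least four has a chord; a chordal cover of a graph is a chordal graph on the same vertex set that contains all its edges. A set $T\subseteq\widehat G$ is a Fourier support of a graph $\Gamma$ on $\widehat G$ if for every maximal clique $C$ of $\Gamma$ there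 is $\chi_C\in\widehat G$ with $\chi_C C\subseteq T$. **Theorem.** Let $f:G_1\times G_2\to\mathbb R$ be a nonnegative function with Fourier support $S_1\times S_2$, where $S_1\subseteq\widehat G_1$ and $S_2\subseteq\widehat G_2$. Let $\Gamma_1$ be a chordal cover of $\operatorname{Cay}(\widehat G_1,S_1)$ with a Fourier support $T_1$, and let $\widehat H\subseteq\widehat G_2$ be the subgroup generated by $S_2$. Then $f$ has an FSOS certificate with Fourier support $T=T_1\times\widehat H$. In particular, $|T|\le|T_1|\cdot|\widehat H|$, and the FSOS sparsity of $f$ is at most $|T_1|\cdot|\widehat H|$. -/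

import Mathlib

/-- The Fourier coefficient of `f : G → ℂ` at the character `χ` of the finite abelian group `G`:
`|G|⁻¹ ∑ x, f x * conj (χ x)`. The dual group of `G` is `AddChar G ℂ`, an abelian group under
pointwise multiplication. -/
noncomputable def fourierCoeffAb {G : Type*} [AddCommGroup G] [Fintype G]
    (f : G → ℂ) (χ : AddChar G ℂ) : ℂ :=
  (Fintype.card G : ℂ)⁻¹ * ∑ x : G, f x * starRingEnd ℂ (χ x)

/-- `S` is a Fourier support of `f`: it contains every character at which the Fourier coefficient
of `f` does not vanish. -/
def IsFourierSupport {G : Type*} [AddCommGroup G] [Fintype G]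
    (f : G → ℂ) (S : Set (AddChar G ℂ)) : Prop :=
  ∀ χ : AddChar G ℂ, fourierCoeffAb f χ ≠ 0 → χ ∈ S

/-- The character `(x₁, x₂) ↦ χ₁ x₁ * χ₂ x₂` of `G₁ × G₂`, through which the product of the dual
groups is identified with the dual group of the product. -/
def charProd {G₁ G₂ : Type*} [AddCommGroup G₁] [AddCommGroup G₂]
    (χ₁ : AddChar G₁ ℂ) (χ₂ : AddChar G₂ ℂ) : AddChar (G₁ × G₂) ℂ :=
  χ₁.compAddMonoidHom (AddMonoidHom.fst G₁ G₂) * χ₂.compAddMonoidHom (AddMonoidHom.snd G₁ G₂)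

/-- The product `S₁ × S₂`, as a subset of the dual group of `G₁ × G₂`. -/
def charSetProd {G₁ G₂ : Type*} [AddCommGroup G₁] [AddCommGroup G₂]
    (S₁ : Set (AddChar G₁ ℂ)) (S₂ : Set (AddChar G₂ ℂ)) : Set (AddChar (G₁ × G₂) ℂ) :=
  Set.image2 charProd S₁ S₂

/-- A graph is chordal if every cycle of length at least four has a chord: an edge that joins two
vertices of the cycle and is not an edge of the cycle. -/
def IsChordalGraph {V : Type*} (Γ : SimpleGraph V) : Prop :=
  ∀ (v : V) (p : Γ.Walk v v), p.IsCycle → 4 ≤ p.length →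
    ∃ x ∈ p.support, ∃ y ∈ p.support, Γ.Adj x y ∧ s(x, y) ∉ p.edges

/-- `Γ` is a chordal cover of `Γ'`: a chordal graph on the same vertices that contains all the
edges of `Γ'`. -/
def IsChordalCover {V : Type*} (Γ Γ' : SimpleGraph V) : Prop :=
  Γ' ≤ Γ ∧ IsChordalGraph Γ

/-- `T` is a Fourier support of the graph `Γ` on the group `X` (a dual group): every maximal clique
of `Γ` has a translate that is contained in `T`. -/
def IsGraphFourierSupport {X : Type*} [CommGroup X] (Γ : SimpleGraph X) (T : Set X) : Prop :=
  ∀ C : Set X, Maximal Γ.IsClique C → ∃ χ : X, ∀ c ∈ C, χ * c ∈ T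

/-- `f` has a Fourier sum of squares certificate with Fourier support `T`: it is a finite sum of
squares `|h i|²` of complex-valued functions that all have `T` as a Fourier support. -/
def HasFSOSCertificate {G : Type*} [AddCommGroup G] [Fintype G]
    (f : G → ℝ) (T : Set (AddChar G ℂ)) : Prop :=
  ∃ (n : ℕ) (h : Fin n → G → ℂ),
    (∀ i, IsFourierSupport (h i) T) ∧ ∀ x : G, f x = ∑ i, ‖h i x‖ ^ 2

/-- The FSOS sparsity of `f`: the least cardinality of a set that is a Fourier support of an FSOS
certificate of `f` (`⊤` if there is no certificate). -/
noncomputable def fsosSparsity {G : Type*} [AddCommGroup G] [Fintype G] (f : G → ℝ) : ℕ∞ :=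
  ⨅ (T : Set (AddChar G ℂ)) (_ : HasFSOSCertificate f T), T.encard

/-! The second variable is separated off by a reproducing kernel. Let `K` be the sum of the
characters in `H`. It is `|H|` times the indicator of the annihilator of `H`, so `|K|² = |H| K`, and
convolution with `K` fixes, up to the factor `|G₂|`, every function with spectrum in `H`. Hence `f
(x, y) = (|G₂| |H|)⁻¹ ∑ z, f (x, z) |K (y - z)|²` (`eq_sum_mul_norm_sq_subgroupKernel`). Each slice
`f (·, z)` is nonnegative with spectrum in `S₁`; if it is a sum of squares `|hᵢ|²` supported on
`T₁`, then the products `hᵢ x * K (y - z)` have spectrum in `T₁ × H`.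

The slices are handled by `hasFSOSCertificate_of_isChordalCover`. The matrix of Fourier coefficients
at `χ * ψ⁻¹` is positive semidefinite, with off-diagonal pattern in the Cayley graph. Eliminating
simplicial vertices of the chordal cover creates no entries outside it, so the matrix is a sum of
terms `w w*` supported on cliques (`PosSemidef.mem_closure_of_isChordalGraph`). Each gives a square
`|∑ χ, w χ * χ x|²`, and multiplying by a unimodular character moves its clique into `T₁`. -/

/-! ### Chordal graphs and simplicial vertices. -/

namespace SimpleGraph

variable {V : Type*} {Γ : SimpleGraph V}

/-- A vertex `v` of `W` is simplicial in the subgraph induced on `W` if its neighbours in `W` are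
pairwise adjacent. -/
def IsSimplicialIn (Γ : SimpleGraph V) (W : Finset V) (v : V) : Prop :=
  v ∈ W ∧ ∀ a ∈ W, ∀ b ∈ W, Γ.Adj v a → Γ.Adj v b → a ≠ b → Γ.Adj a b

/-- A walk with a chord can be shortened within its own support. -/
lemma Walk.exists_shorter_of_chord {s t : V} (p : Γ.Walk s t) {i j : ℕ} (hij : i + 1 < j)
    (hj : j ≤ p.length) (h : Γ.Adj (p.getVert i) (p.getVert j)) :
    ∃ q : Γ.Walk s t, q.length < p.length ∧ ∀ w ∈ q.support, w ∈ p.support := by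
  refine ⟨(p.take i).append (Walk.cons h (p.drop j)), ?_, ?_⟩
  · simp only [Walk.length_append, Walk.length_cons, Walk.take_length, Walk.drop_length]
    omega
  · intro w hw
    rw [Walk.mem_support_append_iff, Walk.support_cons, List.mem_cons] at hw
    rcases hw with hw | rfl | hw
    · exact (p.isSubwalk_take i).support_subset hw
    · exact p.getVert_mem_support i
    · exact (p.isSubwalk_drop j).support_subset hw

/-- In a chordal graph, two distinct neighbours of `x` that are joined by a walk whose other
vertices are neither `x` nor neighbours of `x` are adjacent. -/
lemma adj_of_walk_of_isChordalGraph (hΓ : IsChordalGraph Γ) {x s t : V} (hxs : Γ.Adj x s)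
    (hxt : Γ.Adj x t) (hst : s ≠ t) (p₀ : Γ.Walk s t)
    (hp₀ : ∀ w ∈ p₀.support, w = s ∨ w = t ∨ (w ≠ x ∧ ¬ Γ.Adj x w)) : Γ.Adj s t := by
  classical
  by_contra hadj
  -- A shortest such walk is a path without chords; closed up through `x`, it is a cycle that
  -- contradicts chordality.
  obtain ⟨p, hp, hmin⟩ : ∃ p : Γ.Walk s t,
      (∀ w ∈ p.support, w = s ∨ w = t ∨ (w ≠ x ∧ ¬ Γ.Adj x w)) ∧
      ∀ q : Γ.Walk s t, (∀ w ∈ q.support, w = s ∨ w = t ∨ (w ≠ x ∧ ¬ Γ.Adj x w)) →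
        p.length ≤ q.length := by
    let P : ℕ → Prop := fun n => ∃ p : Γ.Walk s t,
      (∀ w ∈ p.support, w = s ∨ w = t ∨ (w ≠ x ∧ ¬ Γ.Adj x w)) ∧ p.length = n
    have hP : ∃ n, P n := ⟨_, p₀, hp₀, rfl⟩
    obtain ⟨p, hp, hl⟩ := Nat.find_spec hP
    exact ⟨p, hp, fun q hq => hl ▸ Nat.find_min' hP ⟨q, hq, rfl⟩⟩
  have hpath : p.IsPath := by
    have h := hmin p.bypass fun w hw => hp w (p.support_bypass_subset_support hw)
    have h' := p.bypass_eq_self_of_length_le_length_bypass h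
    rw [← h']
    exact p.bypass_isPath
  have hx : x ∉ p.support := by
    intro h
    rcases hp x h with h | h | h
    · exact hxs.ne h
    · exact hxt.ne h
    · exact h.1 rfl
  have hnochord : ∀ i j, i + 1 < j → j ≤ p.length → ¬ Γ.Adj (p.getVert i) (p.getVert j) := by
    intro i j hij hj h
    obtain ⟨q, hq, hsub⟩ := p.exists_shorter_of_chord hij hj h
    exact absurd (hmin q fun w hw => hp w (hsub w hw)) (by omega)
  have hlen : 2 ≤ p.length := by
    by_contra hlt
    have h01 : p.length = 0 ∨ p.length = 1 := by omega
    rcases h01 with h | h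
    · exact hst (Walk.eq_of_length_eq_zero h)
    · exact hadj (Walk.adj_of_length_eq_one h)
  have hcyc : (Walk.cons hxs (p.concat hxt.symm)).IsCycle := by
    rw [Walk.cons_isCycle_iff]
    refine ⟨hpath.concat hx hxt.symm, ?_⟩
    rw [Walk.edges_concat, List.concat_eq_append, List.mem_append, List.mem_singleton]
    rintro (h | h)
    · exact hx (p.fst_mem_support_of_mem_edges h)
    · rw [Sym2.eq_iff] at h
      rcases h with ⟨h, -⟩ | ⟨-, h⟩
      · exact hxt.ne h
      · exact hst h
  obtain ⟨u, hu, v, hv, huv, he⟩ := hΓ x _ hcyc (by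
    rw [Walk.length_cons, Walk.length_concat]; omega)
  simp only [Walk.support_cons, Walk.support_concat, List.mem_cons,
    List.mem_append, List.not_mem_nil, or_false] at hu hv
  simp only [Walk.edges_cons, Walk.edges_concat, List.concat_eq_append, List.mem_cons,
    List.mem_append, List.not_mem_nil, or_false, not_or] at he
  obtain ⟨he1, he2, he3⟩ := he
  -- The only neighbours of `x` on the path are `s` and `t`, so a chord cannot end at `x`.
  have key : ∀ w ∈ p.support, Γ.Adj x w → s(x, w) ≠ s(x, s) → s(t, x) = s(x, w) := by
    intro w hw hxw hne
    rcases hp w hw with rfl | rfl | h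
    · exact absurd rfl hne
    · exact Sym2.eq_swap
    · exact absurd hxw h.2
  have hu' : u = x ∨ u ∈ p.support := by tauto
  have hv' : v = x ∨ v ∈ p.support := by tauto
  rcases hu' with rfl | hu'
  · rcases hv' with rfl | hv'
    · exact huv.ne rfl
    · exact he3 (key v hv' huv he1).symm
  · rcases hv' with rfl | hv'
    · refine he3 ?_
      rw [Sym2.eq_swap] at he1 ⊢
      exact (key u hu' huv.symm he1).symm
    · obtain ⟨i, rfl, hi⟩ := Walk.mem_support_iff_exists_getVert.mp hu'
      obtain ⟨j, rfl, hj⟩ := Walk.mem_support_iff_exists_getVert.mp hv'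
      rw [Walk.mk_mem_edges_iff_exists] at he2
      rcases lt_trichotomy i j with h | rfl | h
      · rcases Nat.lt_or_ge (i + 1) j with h' | h'
        · exact hnochord i j h' hj huv
        · obtain rfl : j = i + 1 := by omega
          exact he2 ⟨i, by omega, rfl⟩
      · exact huv.ne rfl
      · rcases Nat.lt_or_ge (j + 1) i with h' | h'
        · exact hnochord j i h' hi huv.symm
        · obtain rfl : i = j + 1 := by omega
          exact he2 ⟨j, by omega, Sym2.eq_swap⟩

/-- Dirac: in an induced subgraph of a chordal graph, every vertex that is not adjacent to all
others has a simplicial vertex among its non-neighbours. -/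
lemma exists_isSimplicialIn_not_adj (hΓ : IsChordalGraph Γ) (W : Finset V) :
    ∀ x ∈ W, (∃ y ∈ W, y ≠ x ∧ ¬ Γ.Adj x y) →
      ∃ z, Γ.IsSimplicialIn W z ∧ z ≠ x ∧ ¬ Γ.Adj x z := by
  classical
  induction W using Finset.strongInduction with
  | H W ih =>
  rintro x hxW ⟨y, hyW, hyx, hxy⟩
  -- `A` is the component of `y` among the non-neighbours of `x`. Its boundary `S` in `W` consists
  -- of neighbours of `x`, and is a clique because any two of its points are joined through `A`.
  let R : Set V := {w | w ∈ W ∧ w ≠ x ∧ ¬ Γ.Adj x w}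
  let A : Set V := {a | ∃ p : Γ.Walk y a, ∀ w ∈ p.support, w ∈ R}
  have hAR : A ⊆ R := fun a ⟨p, hp⟩ => hp a p.end_mem_support
  have hyA : y ∈ A := ⟨Walk.nil, fun w hw => by
    rw [Walk.support_nil, List.mem_singleton] at hw
    exact hw ▸ ⟨hyW, hyx, hxy⟩⟩
  have hAext : ∀ a ∈ A, ∀ b ∈ R, Γ.Adj a b → b ∈ A := by
    rintro a ⟨p, hp⟩ b hb hab
    refine ⟨p.concat hab, fun w hw => ?_⟩
    rw [Walk.support_concat, List.mem_append, List.mem_singleton] at hw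
    rcases hw with hw | rfl
    exacts [hp w hw, hb]
  let S : Set V := {s | s ∈ W ∧ s ∉ A ∧ ∃ a ∈ A, Γ.Adj a s}
  have hxS : ∀ s ∈ S, Γ.Adj x s := by
    rintro s ⟨hsW, hsA, a, ha, has⟩
    by_contra h
    refine hsA (hAext a ha s ⟨hsW, ?_, h⟩ has)
    rintro rfl
    exact (hAR ha).2.2 has.symm
  have hAA : ∀ a ∈ A, ∀ b ∈ A, ∃ p : Γ.Walk a b, ∀ w ∈ p.support, w ∈ R := by
    rintro a ⟨p, hp⟩ b ⟨q, hq⟩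
    refine ⟨p.reverse.append q, fun w hw => ?_⟩
    rw [Walk.mem_support_append_iff, Walk.support_reverse, List.mem_reverse] at hw
    exact hw.elim (hp w) (hq w)
  have hSclique : ∀ s ∈ S, ∀ t ∈ S, s ≠ t → Γ.Adj s t := by
    intro s hs t ht hst
    obtain ⟨a, ha, has⟩ := hs.2.2
    obtain ⟨b, hb, hbt⟩ := ht.2.2
    obtain ⟨p, hp⟩ := hAA a ha b hb
    refine adj_of_walk_of_isChordalGraph hΓ (hxS s hs) (hxS t ht) hst
      (Walk.cons has.symm (p.concat hbt)) fun w hw => ?_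
    rw [Walk.support_cons, List.mem_cons, Walk.support_concat, List.mem_append,
      List.mem_singleton] at hw
    rcases hw with hw | hw | hw
    · exact Or.inl hw
    · exact Or.inr (Or.inr (hp w hw).2)
    · exact Or.inr (Or.inl hw)
  have hlift : ∀ z ∈ A, (∀ a ∈ A ∪ S, ∀ b ∈ A ∪ S, Γ.Adj z a → Γ.Adj z b → a ≠ b → Γ.Adj a b) →
      ∃ z, Γ.IsSimplicialIn W z ∧ z ≠ x ∧ ¬ Γ.Adj x z := by
    intro z hz h
    have hN : ∀ a ∈ W, Γ.Adj z a → a ∈ A ∪ S := fun a haW hza => by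
      by_cases haA : a ∈ A
      · exact Or.inl haA
      · exact Or.inr ⟨haW, haA, z, hz, hza⟩
    exact ⟨z, ⟨(hAR hz).1, fun a ha b hb hza hzb hab =>
      h a (hN a ha hza) b (hN b hb hzb) hza hzb hab⟩, (hAR hz).2⟩
  by_cases hcl : ∀ a ∈ A ∪ S, ∀ b ∈ A ∪ S, a ≠ b → Γ.Adj a b
  · exact hlift y hyA fun a ha b hb _ _ hab => hcl a ha b hb hab
  push Not at hcl
  obtain ⟨a, ha, b, hb, hab, hnab⟩ := hcl
  -- Vertices of `A` have all their `W`-neighbours in `A ∪ S`, so it suffices to find a vertex of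
  -- `A` that is simplicial in this smaller set, which omits `x`.
  let W' : Finset V := W.filter (· ∈ A ∪ S)
  have hmem : ∀ w, w ∈ W' ↔ w ∈ A ∪ S := fun w => by
    refine Finset.mem_filter.trans (and_iff_right_of_imp ?_)
    rintro (h | h)
    exacts [(hAR h).1, h.1]
  have hss : W' ⊂ W := by
    refine Finset.filter_ssubset.mpr ⟨x, hxW, ?_⟩
    rintro (h | h)
    · exact (hAR h).2.1 rfl
    · exact (hxS x h).ne rfl
  obtain ⟨z, hz, hzA⟩ : ∃ z, Γ.IsSimplicialIn W' z ∧ z ∈ A := by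
    -- Induction from `s` yields a non-neighbour of `s`, which the clique `S` cannot contain. If no
    -- such `s` exists, all of `S` is adjacent to everything in `W'`, and induction from `a` avoids
    -- `S`.
    by_cases hS : ∃ s ∈ S, ∃ w ∈ W', w ≠ s ∧ ¬ Γ.Adj s w
    · obtain ⟨s, hs, hw⟩ := hS
      obtain ⟨z, hz, hzs, hsz⟩ := ih W' hss s ((hmem s).2 (Or.inr hs)) hw
      exact ⟨z, hz, ((hmem z).1 hz.1).resolve_right fun h => hsz (hSclique s hs z h hzs.symm)⟩
    · push Not at hS
      obtain ⟨z, hz, hza, haz⟩ := ih W' hss a ((hmem a).2 ha) ⟨b, (hmem b).2 hb, hab.symm, hnab⟩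
      exact ⟨z, hz, ((hmem z).1 hz.1).resolve_right fun h =>
        haz (hS z h a ((hmem a).2 ha) hza.symm).symm⟩
  exact hlift z hzA fun c hc d hd => hz.2 c ((hmem c).2 hc) d ((hmem d).2 hd)

lemma exists_isSimplicialIn (hΓ : IsChordalGraph Γ) {W : Finset V} (hW : W.Nonempty) :
    ∃ z, Γ.IsSimplicialIn W z := by
  by_cases hcl : ∀ a ∈ W, ∀ b ∈ W, a ≠ b → Γ.Adj a b
  · obtain ⟨z, hz⟩ := hW
    exact ⟨z, hz, fun a ha b hb _ _ hab => hcl a ha b hb hab⟩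
  · push Not at hcl
    obtain ⟨a, ha, b, hb, hab, hnab⟩ := hcl
    obtain ⟨z, hz, -⟩ := exists_isSimplicialIn_not_adj hΓ W a ha ⟨b, hb, hab.symm, hnab⟩
    exact ⟨z, hz⟩

end SimpleGraph

/-! ### Positive semidefinite matrices with chordal sparsity pattern. -/

namespace Matrix

open scoped ComplexOrder

variable {V : Type*} [Fintype V]

/-- Symmetric Gaussian elimination of one row and column keeps a matrix positive semidefinite. -/
lemma PosSemidef.sub_vecMulVec_col_row [DecidableEq V] {M : Matrix V V ℂ} (hM : M.PosSemidef)
    {z : V} (hz : M z z ≠ 0) :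
    (M - vecMulVec (fun u => M u z) (fun v => M z v / M z z)).PosSemidef := by
  set r : V → ℂ := fun v => M z v / M z z with hr
  have h1 : M * (1 - vecMulVec (Pi.single z 1) r) = M - vecMulVec (fun u => M u z) r := by
    rw [Matrix.mul_sub, Matrix.mul_one, mul_vecMulVec, mulVec_single_one]
    rfl
  -- The right factor of the congruence has already cleared row `z`, so the left factor changes
  -- nothing.
  have h2 : (1 - vecMulVec (Pi.single z 1) r)ᴴ * (M - vecMulVec (fun u => M u z) r) =
      M - vecMulVec (fun u => M u z) r := by
    have hs : star (Pi.single z 1 : V → ℂ) = Pi.single z 1 := by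
      rw [← Pi.single_star, star_one]
    have h0 : (M - vecMulVec (fun u => M u z) r).row z = 0 := by
      ext v
      simp only [row_apply, sub_apply, vecMulVec_apply, Pi.zero_apply, hr]
      field_simp
      ring
    rw [conjTranspose_sub, conjTranspose_one, conjTranspose_vecMulVec, Matrix.sub_mul,
      Matrix.one_mul, vecMulVec_mul, hs, single_one_vecMul, h0]
    simp
  have h := hM.conjTranspose_mul_mul_same (1 - vecMulVec (Pi.single z 1) r)
  rwa [Matrix.mul_assoc, h1, h2] at h

lemma PosSemidef.apply_eq_zero_of_diag_eq_zero {M : Matrix V V ℂ} (hM : M.PosSemidef)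
    {z : V} (hz : M z z = 0) (u : V) : M u z = 0 ∧ M z u = 0 := by
  classical
  have h := (hM.dotProduct_mulVec_zero_iff (Pi.single z 1)).1 (by
    rw [mulVec_single_one, ← Pi.single_star, star_one, single_one_dotProduct]
    exact hz)
  rw [mulVec_single_one] at h
  have hu : M u z = 0 := congrFun h u
  exact ⟨hu, by rw [← hM.1.apply, hu, star_zero]⟩

/-- A positive semidefinite matrix whose off-diagonal sparsity pattern is a chordal graph is a sum
of positive semidefinite matrices of rank one that are supported on cliques. -/
lemma PosSemidef.mem_closure_of_isChordalGraph {Γ : SimpleGraph V} (hΓ : IsChordalGraph Γ)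
    (W : Finset V) : ∀ M : Matrix V V ℂ, M.PosSemidef →
      (∀ u v, M u v ≠ 0 → u ∈ W ∧ v ∈ W ∧ (u ≠ v → Γ.Adj u v)) →
      M ∈ AddSubmonoid.closure
        {N | ∃ w : V → ℂ, Γ.IsClique (Function.support w) ∧ N = vecMulVec w (star w)} := by
  classical
  induction W using Finset.strongInduction with
  | H W ih =>
  intro M hM hsupp
  rcases W.eq_empty_or_nonempty with rfl | hW
  · have h0 : M = 0 := by
      ext u v
      by_contra h
      exact absurd (hsupp u v h).1 (Finset.notMem_empty u)
    exact h0 ▸ zero_mem _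
  obtain ⟨z, hzW, hz⟩ := SimpleGraph.exists_isSimplicialIn hΓ hW
  by_cases hd : M z z = 0
  · refine ih (W.erase z) (Finset.erase_ssubset hzW) M hM fun u v h => ?_
    obtain ⟨hu, hv, huv⟩ := hsupp u v h
    refine ⟨Finset.mem_erase.2 ⟨?_, hu⟩, Finset.mem_erase.2 ⟨?_, hv⟩, huv⟩
    · rintro rfl
      exact h (hM.apply_eq_zero_of_diag_eq_zero hd v).2
    · rintro rfl
      exact h (hM.apply_eq_zero_of_diag_eq_zero hd u).1
  have hd0 : 0 ≤ M z z := hM.diag_nonneg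
  obtain ⟨r, hr⟩ : ∃ r : ℝ, (r : ℂ) * r = M z z := by
    refine ⟨Real.sqrt (M z z).re, ?_⟩
    rw [← Complex.ofReal_mul, Real.mul_self_sqrt (Complex.le_def.1 hd0).1]
    exact Complex.ext rfl (Complex.le_def.1 hd0).2
  have hr0 : (r : ℂ) ≠ 0 := by
    intro h
    rw [h, mul_zero] at hr
    exact hd hr.symm
  -- Dividing the pivot column by the square root of the pivot makes the eliminated term `w w*`; its
  -- support is a clique since `z` is simplicial.
  set w : V → ℂ := fun u => M u z / r with hw
  have hwM : ∀ u, w u ≠ 0 → M u z ≠ 0 := fun u h h' => h (by rw [hw]; simp [h'])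
  have hclique : Γ.IsClique (Function.support w) := by
    intro a ha b hb hab
    obtain ⟨haW, -, haz⟩ := hsupp a z (hwM a ha)
    obtain ⟨hbW, -, hbz⟩ := hsupp b z (hwM b hb)
    by_cases h1 : a = z
    · subst h1
      exact (hbz hab.symm).symm
    by_cases h2 : b = z
    · subst h2
      exact haz hab
    exact hz a haW b hbW (haz h1).symm (hbz h2).symm hab
  have hrank : vecMulVec (fun u => M u z) (fun v => M z v / M z z) = vecMulVec w (star w) := by
    ext u v
    have hv : star (M v z) = M z v := hM.1.apply z v
    simp only [vecMulVec_apply, Pi.star_apply, hw, star_div₀, hv, ← hr]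
    rw [show star (r : ℂ) = r from Complex.conj_ofReal r]
    field_simp
  have hM' := hM.sub_vecMulVec_col_row hd
  have hrow : ∀ v, (M - vecMulVec w (star w)) z v = 0 := fun v => by
    rw [← hrank, sub_apply, vecMulVec_apply]
    field_simp
    ring
  rw [hrank] at hM'
  have hcol : ∀ u, (M - vecMulVec w (star w)) u z = 0 := fun u => by
    rw [← hM'.1.apply, hrow, star_zero]
  rw [← sub_add_cancel M (vecMulVec w (star w))]
  refine add_mem (ih (W.erase z) (Finset.erase_ssubset hzW) _ hM' fun u v h => ?_)
    (AddSubmonoid.subset_closure ⟨w, hclique, rfl⟩)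
  have huz : u ≠ z := by rintro rfl; exact h (hrow v)
  have hvz : v ≠ z := by rintro rfl; exact h (hcol u)
  simp only [Finset.mem_erase, ne_eq, huz, hvz, not_false_eq_true, true_and]
  -- Fill-in at `(u, v)` can only come from `w w*`, so it stays inside the clique.
  by_cases hMuv : M u v = 0
  · rw [sub_apply, hMuv, zero_sub, neg_ne_zero, vecMulVec_apply] at h
    have hu : w u ≠ 0 := left_ne_zero_of_mul h
    have hv : w v ≠ 0 := fun h' => right_ne_zero_of_mul h (by rw [Pi.star_apply, h', star_zero])
    exact ⟨(hsupp u z (hwM u hu)).1, (hsupp v z (hwM v hv)).1, fun huv => hclique hu hv huv⟩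
  · exact hsupp u v hMuv

end Matrix

/-! ### Fourier supports and the cone of functions with a certificate. -/

section FourierSupport

variable {G : Type*} [AddCommGroup G] [Fintype G]

lemma AddChar.mul_conj_apply (ψ χ : AddChar G ℂ) (x : G) :
    ψ x * starRingEnd ℂ (χ x) = (ψ * χ⁻¹) x := by
  rw [AddChar.mul_apply, AddChar.inv_apply, AddChar.map_neg_eq_conj]

lemma isFourierSupport_sum_addChar {ι : Type*} [Fintype ι] {T : Set (AddChar G ℂ)} (c : ι → ℂ)
    (ψ : ι → AddChar G ℂ) (h : ∀ i, c i ≠ 0 → ψ i ∈ T) :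
    IsFourierSupport (fun x => ∑ i, c i * ψ i x) T := by
  intro χ hχ
  have hsum : ∑ x : G, (∑ i, c i * ψ i x) * starRingEnd ℂ (χ x) =
      ∑ i, c i * ∑ x, (ψ i * χ⁻¹) x := by
    simp only [Finset.sum_mul, Finset.mul_sum, ← AddChar.mul_conj_apply, mul_assoc]
    exact Finset.sum_comm
  rw [fourierCoeffAb, hsum] at hχ
  obtain ⟨i, -, hi⟩ := Finset.exists_ne_zero_of_sum_ne_zero (right_ne_zero_of_mul hχ)
  have hψ : ψ i * χ⁻¹ = 1 := AddChar.sum_ne_zero_iff_eq_zero.1 (right_ne_zero_of_mul hi)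
  rw [← mul_inv_eq_one.1 hψ]
  exact h i (left_ne_zero_of_mul hi)

/-- Fourier inversion on a finite abelian group. -/
lemma sum_fourierCoeffAb_mul_apply (f : G → ℂ) (x : G) :
    ∑ χ : AddChar G ℂ, fourierCoeffAb f χ * χ x = f x := by
  classical
  have hcard : (Fintype.card G : ℂ) ≠ 0 := Nat.cast_ne_zero.2 Fintype.card_ne_zero
  have h : ∀ χ : AddChar G ℂ, fourierCoeffAb f χ * χ x =
      (Fintype.card G : ℂ)⁻¹ * ∑ y, f y * χ (x - y) := fun χ => by
    rw [fourierCoeffAb, mul_assoc, Finset.sum_mul]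
    congr 1
    refine Finset.sum_congr rfl fun y _ => ?_
    rw [sub_eq_add_neg, AddChar.map_add_eq_mul, AddChar.map_neg_eq_conj]
    ring
  simp only [h, ← Finset.mul_sum]
  rw [Finset.sum_comm]
  simp only [← Finset.mul_sum, AddChar.sum_apply_eq_ite, sub_eq_zero, mul_ite, mul_zero,
    Finset.sum_ite_eq, Finset.mem_univ, if_true]
  field_simp

lemma IsFourierSupport.const_mul {f : G → ℂ} {T : Set (AddChar G ℂ)} (hf : IsFourierSupport f T)
    (c : ℂ) : IsFourierSupport (fun x => c * f x) T := by
  intro χ hχ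
  refine hf χ fun h => hχ ?_
  have : fourierCoeffAb (fun x => c * f x) χ = c * fourierCoeffAb f χ := by
    simp only [fourierCoeffAb, Finset.mul_sum]
    exact Finset.sum_congr rfl fun x _ => by ring
  rw [this, h, mul_zero]

lemma HasFSOSCertificate.zero (T : Set (AddChar G ℂ)) :
    HasFSOSCertificate (fun _ : G => (0 : ℝ)) T :=
  ⟨0, fun i => i.elim0, fun i => i.elim0, fun _ => by simp⟩

lemma HasFSOSCertificate.add {f g : G → ℝ} {T : Set (AddChar G ℂ)}
    (hf : HasFSOSCertificate f T) (hg : HasFSOSCertificate g T) :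
    HasFSOSCertificate (fun x => f x + g x) T := by
  obtain ⟨n, a, ha, hfa⟩ := hf
  obtain ⟨m, b, hb, hgb⟩ := hg
  refine ⟨n + m, Fin.append a b, fun i => ?_, fun x => ?_⟩
  · refine Fin.addCases (fun j => ?_) (fun j => ?_) i
    · rw [Fin.append_left]; exact ha j
    · rw [Fin.append_right]; exact hb j
  · simp [Fin.sum_univ_add, hfa, hgb]

lemma HasFSOSCertificate.sum {ι : Type*} (s : Finset ι) {f : ι → G → ℝ} {T : Set (AddChar G ℂ)}
    (hf : ∀ i ∈ s, HasFSOSCertificate (f i) T) :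
    HasFSOSCertificate (fun x => ∑ i ∈ s, f i x) T := by
  classical
  induction s using Finset.induction_on with
  | empty => simpa using HasFSOSCertificate.zero T
  | insert i s hi ih =>
    simp only [Finset.sum_insert hi]
    exact (hf i (Finset.mem_insert_self i s)).add
      (ih fun j hj => hf j (Finset.mem_insert_of_mem hj))

lemma HasFSOSCertificate.const_mul {f : G → ℝ} {T : Set (AddChar G ℂ)}
    (hf : HasFSOSCertificate f T) {c : ℝ} (hc : 0 ≤ c) :
    HasFSOSCertificate (fun x => c * f x) T := by
  obtain ⟨n, h, hh, hfh⟩ := hf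
  refine ⟨n, fun i x => (Real.sqrt c : ℂ) * h i x, fun i => (hh i).const_mul _, fun x => ?_⟩
  simp only [hfh, norm_mul, mul_pow, Finset.mul_sum, Complex.norm_real, Real.norm_eq_abs, sq_abs,
    Real.sq_sqrt hc]

lemma IsFourierSupport.hasFSOSCertificate {h : G → ℂ} {T : Set (AddChar G ℂ)}
    (hh : IsFourierSupport h T) : HasFSOSCertificate (fun x => ‖h x‖ ^ 2) T :=
  ⟨1, fun _ => h, fun _ => hh, fun x => by simp⟩

end FourierSupport

/-! ### Certificates on one group from chordal covers. -/

section OneGroup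

open Matrix
open scoped ComplexOrder

variable {G : Type*} [AddCommGroup G] [Fintype G]

/-- The matrix of multiplication by `f` in the basis of characters. -/
noncomputable def fourierMatrix (f : G → ℂ) : Matrix (AddChar G ℂ) (AddChar G ℂ) ℂ :=
  Matrix.of fun χ ψ => fourierCoeffAb f (χ * ψ⁻¹)

/-- The matrix is the combination, with weights `f x / |G|`, of the rank-one matrices of the vectors
of conjugate character values at `x`. -/
lemma posSemidef_fourierMatrix {f : G → ℝ} (hf : ∀ x, 0 ≤ f x) :
    (fourierMatrix fun x => (f x : ℂ)).PosSemidef := by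
  have h : fourierMatrix (fun x => (f x : ℂ)) = ∑ x : G, ((Fintype.card G : ℝ)⁻¹ * f x) •
      vecMulVec (fun χ : AddChar G ℂ => starRingEnd ℂ (χ x))
        (star fun χ : AddChar G ℂ => starRingEnd ℂ (χ x)) := by
    ext χ ψ
    simp only [fourierMatrix, of_apply, fourierCoeffAb, Finset.mul_sum, Matrix.sum_apply,
      Matrix.smul_apply, vecMulVec_apply, Pi.star_apply, ← AddChar.mul_conj_apply, map_mul,
      Complex.real_smul, Complex.ofReal_mul, Complex.ofReal_inv, Complex.ofReal_natCast,
      starRingEnd_apply]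
    exact Finset.sum_congr rfl fun x _ => by ring
  rw [h]
  exact posSemidef_sum _ fun x _ => (posSemidef_vecMulVec_self_star _).smul
    (mul_nonneg (inv_nonneg.2 (Nat.cast_nonneg _)) (hf x))

/-- For each fixed `ψ`, replacing `χ` by `χ * ψ` turns the inner sum into Fourier inversion, so
every `ψ` contributes one copy of `f x`. -/
lemma sum_sum_fourierMatrix (f : G → ℂ) (x : G) :
    ∑ ψ : AddChar G ℂ, ∑ χ : AddChar G ℂ, χ x * fourierMatrix f χ ψ * starRingEnd ℂ (ψ x) =
      Fintype.card (AddChar G ℂ) * f x := by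
  have h : ∀ ψ : AddChar G ℂ,
      ∑ χ : AddChar G ℂ, χ x * fourierMatrix f χ ψ * starRingEnd ℂ (ψ x) = f x := fun ψ => by
    rw [← sum_fourierCoeffAb_mul_apply f x]
    refine Fintype.sum_equiv (Equiv.mulRight ψ⁻¹) _ _ fun χ => ?_
    rw [Equiv.coe_mulRight, ← AddChar.mul_conj_apply, fourierMatrix, of_apply]
    ring
  simp [h]

/-- A clique of a graph with Fourier support `T` has a translate in `T`. -/
lemma IsGraphFourierSupport.exists_mul_mem {X : Type*} [CommGroup X] [Finite X]
    {Γ : SimpleGraph X} {T : Set X} (hT : IsGraphFourierSupport Γ T) {C : Set X}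
    (hC : Γ.IsClique C) : ∃ χ : X, ∀ c ∈ C, χ * c ∈ T := by
  obtain ⟨D, hCD, hD⟩ := Finite.exists_le_maximal hC
  obtain ⟨χ, hχ⟩ := hT D hD
  exact ⟨χ, fun c hc => hχ c (hCD hc)⟩

/-- Characters have modulus one, so a clique may be translated into `T` without changing the square.
-/
lemma hasFSOSCertificate_norm_sq_of_isClique {Γ : SimpleGraph (AddChar G ℂ)}
    {T : Set (AddChar G ℂ)} (hT : IsGraphFourierSupport Γ T) {w : AddChar G ℂ → ℂ}
    (hw : Γ.IsClique (Function.support w)) :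
    HasFSOSCertificate (fun x => ‖∑ χ, w χ * χ x‖ ^ 2) T := by
  obtain ⟨φ, hφ⟩ := hT.exists_mul_mem hw
  have h := (isFourierSupport_sum_addChar w (φ * ·) fun χ hχ => hφ χ hχ).hasFSOSCertificate
  convert h using 2 with x
  have : ∑ χ, w χ * (φ * χ) x = φ x * ∑ χ, w χ * χ x := by
    rw [Finset.mul_sum]
    exact Finset.sum_congr rfl fun χ _ => by rw [AddChar.mul_apply]; ring
  rw [this, norm_mul, AddChar.norm_apply, one_mul]

/-- The trigonometric form of a sum of rank one matrices supported on cliques has an FSOS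
certificate. -/
lemma exists_hasFSOSCertificate_of_mem_closure {Γ : SimpleGraph (AddChar G ℂ)}
    {T : Set (AddChar G ℂ)} (hT : IsGraphFourierSupport Γ T)
    {M : Matrix (AddChar G ℂ) (AddChar G ℂ) ℂ}
    (hM : M ∈ AddSubmonoid.closure {N | ∃ w : AddChar G ℂ → ℂ,
      Γ.IsClique (Function.support w) ∧ N = vecMulVec w (star w)}) :
    ∃ k : G → ℝ, HasFSOSCertificate k T ∧ ∀ x, ∑ ψ : AddChar G ℂ,
      ∑ χ : AddChar G ℂ, χ x * M χ ψ * starRingEnd ℂ (ψ x) = k x := by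
  induction hM using AddSubmonoid.closure_induction with
  | mem N hN =>
    obtain ⟨w, hw, rfl⟩ := hN
    refine ⟨fun x => ‖∑ χ, w χ * χ x‖ ^ 2, hasFSOSCertificate_norm_sq_of_isClique hT hw,
      fun x => ?_⟩
    rw [Complex.ofReal_pow, ← Complex.mul_conj', map_sum, Finset.sum_mul_sum, Finset.sum_comm]
    refine Finset.sum_congr rfl fun χ _ => Finset.sum_congr rfl fun ψ _ => ?_
    rw [vecMulVec_apply, Pi.star_apply, map_mul, starRingEnd_apply, starRingEnd_apply]
    ring
  | zero => exact ⟨fun _ => 0, HasFSOSCertificate.zero T, fun x => by simp⟩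
  | add N N' _ _ hN hN' =>
    obtain ⟨k, hk, hN⟩ := hN
    obtain ⟨k', hk', hN'⟩ := hN'
    refine ⟨fun x => k x + k' x, hk.add hk', fun x => ?_⟩
    simp only [Matrix.add_apply, mul_add, add_mul, Finset.sum_add_distrib, hN, hN',
      Complex.ofReal_add]

/-- A nonnegative function on a finite abelian group has an FSOS certificate supported on every
Fourier support of a chordal cover of the Cayley graph of its spectrum. -/
theorem hasFSOSCertificate_of_isChordalCover {f : G → ℝ} (hf : ∀ x, 0 ≤ f x)
    {S : Set (AddChar G ℂ)} (hS : IsFourierSupport (fun x => (f x : ℂ)) S)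
    {Γ : SimpleGraph (AddChar G ℂ)} (hΓ : IsChordalCover Γ (SimpleGraph.mulCayley S))
    {T : Set (AddChar G ℂ)} (hT : IsGraphFourierSupport Γ T) : HasFSOSCertificate f T := by
  have hmem := (posSemidef_fourierMatrix hf).mem_closure_of_isChordalGraph hΓ.2 Finset.univ _
    fun χ ψ h => ⟨Finset.mem_univ _, Finset.mem_univ _, fun hne => hΓ.1
      ((SimpleGraph.mulCayley_adj' S χ ψ).2
        ⟨hne, _, hS _ h, Or.inr (by rw [mul_comm, inv_mul_cancel_right])⟩)⟩
  obtain ⟨k, hk, hfk⟩ := exists_hasFSOSCertificate_of_mem_closure hT hmem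
  have hcard : (Fintype.card (AddChar G ℂ) : ℝ) ≠ 0 := Nat.cast_ne_zero.2 Fintype.card_ne_zero
  convert hk.const_mul (inv_nonneg.2 (Nat.cast_nonneg (Fintype.card (AddChar G ℂ)))) using 2 with x
  have h := hfk x
  rw [sum_sum_fourierMatrix] at h
  have h' : (Fintype.card (AddChar G ℂ) : ℝ) * f x = k x := by exact_mod_cast h
  rw [← h', inv_mul_cancel_left₀ hcard]

end OneGroup

/-! ### Slices and products of functions on a product group. -/

section Product

variable {G₁ G₂ : Type*} [AddCommGroup G₁] [AddCommGroup G₂]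

lemma charProd_apply (χ₁ : AddChar G₁ ℂ) (χ₂ : AddChar G₂ ℂ) (p : G₁ × G₂) :
    charProd χ₁ χ₂ p = χ₁ p.1 * χ₂ p.2 := rfl

lemma charProd_compAddMonoidHom_inl (χ₁ : AddChar G₁ ℂ) (χ₂ : AddChar G₂ ℂ) :
    (charProd χ₁ χ₂).compAddMonoidHom (AddMonoidHom.inl G₁ G₂) = χ₁ := by
  ext x
  simp [charProd_apply]

lemma charProd_compAddMonoidHom_inr (χ₁ : AddChar G₁ ℂ) (χ₂ : AddChar G₂ ℂ) :
    (charProd χ₁ χ₂).compAddMonoidHom (AddMonoidHom.inr G₁ G₂) = χ₂ := by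
  ext x
  simp [charProd_apply]

lemma AddChar.apply_prodMk (χ : AddChar (G₁ × G₂) ℂ) (x : G₁) (y : G₂) :
    χ (x, y) = χ (x, 0) * χ (0, y) := by
  rw [← AddChar.map_add_eq_mul, Prod.mk_add_mk, add_zero, zero_add]

lemma encard_charSetProd_le (S₁ : Set (AddChar G₁ ℂ)) (S₂ : Set (AddChar G₂ ℂ)) :
    (charSetProd S₁ S₂).encard ≤ S₁.encard * S₂.encard := by
  rw [charSetProd, ← Set.image_prod, ← Set.encard_prod]
  exact Set.encard_image_le _ _

variable [Fintype G₁] [Fintype G₂]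

/-- Fixing `y` in the Fourier expansion turns the second factor of each character into a scalar. -/
lemma IsFourierSupport.slice_left {F : G₁ × G₂ → ℂ} {S₁ : Set (AddChar G₁ ℂ)}
    {S₂ : Set (AddChar G₂ ℂ)} (hF : IsFourierSupport F (charSetProd S₁ S₂)) (y : G₂) :
    IsFourierSupport (fun x => F (x, y)) S₁ := by
  have h := isFourierSupport_sum_addChar (T := S₁)
    (fun χ : AddChar (G₁ × G₂) ℂ => fourierCoeffAb F χ * χ (0, y))
    (fun χ => χ.compAddMonoidHom (AddMonoidHom.inl G₁ G₂)) fun χ hχ => by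
      obtain ⟨χ₁, h₁, χ₂, -, rfl⟩ := hF χ (left_ne_zero_of_mul hχ)
      rwa [charProd_compAddMonoidHom_inl]
  convert h using 2 with x
  rw [← sum_fourierCoeffAb_mul_apply F]
  refine Finset.sum_congr rfl fun χ _ => ?_
  rw [AddChar.apply_prodMk, AddChar.compAddMonoidHom_apply, AddMonoidHom.inl_apply]
  ring

lemma IsFourierSupport.slice_right {F : G₁ × G₂ → ℂ} {S₁ : Set (AddChar G₁ ℂ)}
    {S₂ : Set (AddChar G₂ ℂ)} (hF : IsFourierSupport F (charSetProd S₁ S₂)) (x : G₁) :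
    IsFourierSupport (fun y => F (x, y)) S₂ := by
  have h := isFourierSupport_sum_addChar (T := S₂)
    (fun χ : AddChar (G₁ × G₂) ℂ => fourierCoeffAb F χ * χ (x, 0))
    (fun χ => χ.compAddMonoidHom (AddMonoidHom.inr G₁ G₂)) fun χ hχ => by
      obtain ⟨χ₁, -, χ₂, h₂, rfl⟩ := hF χ (left_ne_zero_of_mul hχ)
      rwa [charProd_compAddMonoidHom_inr]
  convert h using 2 with y
  rw [← sum_fourierCoeffAb_mul_apply F]
  refine Finset.sum_congr rfl fun χ _ => ?_
  rw [AddChar.apply_prodMk, AddChar.compAddMonoidHom_apply, AddMonoidHom.inr_apply]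
  ring

lemma IsFourierSupport.mul_prod {a : G₁ → ℂ} {b : G₂ → ℂ} {T₁ : Set (AddChar G₁ ℂ)}
    {T₂ : Set (AddChar G₂ ℂ)} (ha : IsFourierSupport a T₁) (hb : IsFourierSupport b T₂) :
    IsFourierSupport (fun p : G₁ × G₂ => a p.1 * b p.2) (charSetProd T₁ T₂) := by
  have h := isFourierSupport_sum_addChar (T := charSetProd T₁ T₂)
    (fun i : AddChar G₁ ℂ × AddChar G₂ ℂ => fourierCoeffAb a i.1 * fourierCoeffAb b i.2)
    (fun i => charProd i.1 i.2) fun i hi =>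
      ⟨i.1, ha _ (left_ne_zero_of_mul hi), i.2, hb _ (right_ne_zero_of_mul hi), rfl⟩
  convert h using 2 with p
  rw [← sum_fourierCoeffAb_mul_apply a, ← sum_fourierCoeffAb_mul_apply b, Finset.sum_mul_sum,
    Fintype.sum_prod_type]
  refine Finset.sum_congr rfl fun χ _ => Finset.sum_congr rfl fun ψ _ => ?_
  rw [charProd_apply]
  ring

lemma HasFSOSCertificate.mul_norm_sq {g : G₁ → ℝ} {b : G₂ → ℂ} {T₁ : Set (AddChar G₁ ℂ)}
    {T₂ : Set (AddChar G₂ ℂ)} (hg : HasFSOSCertificate g T₁) (hb : IsFourierSupport b T₂) :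
    HasFSOSCertificate (fun p : G₁ × G₂ => g p.1 * ‖b p.2‖ ^ 2) (charSetProd T₁ T₂) := by
  obtain ⟨n, h, hh, hgh⟩ := hg
  refine ⟨n, fun i p => h i p.1 * b p.2, fun i => (hh i).mul_prod hb, fun p => ?_⟩
  simp only [hgh, norm_mul, mul_pow, Finset.sum_mul]

end Product

/-! ### The reproducing kernel of a subgroup of the dual group. -/

section SubgroupKernel

variable {G : Type*} [AddCommGroup G] [Fintype G] (H : Subgroup (AddChar G ℂ)) [Fintype H]

/-- The sum of the characters in a subgroup of the dual group: up to a factor the indicator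
function of the annihilator of the subgroup. -/
noncomputable def subgroupKernel (x : G) : ℂ := ∑ χ : H, (χ : AddChar G ℂ) x

/-- In the expanded square, translating the sum over `χ` by `ψ⁻¹` permutes `H`, so each `ψ`
contributes the whole kernel. This makes the kernel a multiple of a square. -/
lemma norm_sq_subgroupKernel (x : G) :
    ((‖subgroupKernel H x‖ ^ 2 : ℝ) : ℂ) = Fintype.card H * subgroupKernel H x := by
  have h : ∀ ψ : H, ∑ χ : H, (χ : AddChar G ℂ) x * starRingEnd ℂ ((ψ : AddChar G ℂ) x) =
      subgroupKernel H x := fun ψ => by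
    exact Fintype.sum_equiv (Equiv.mulRight ψ⁻¹) _ _ fun χ => AddChar.mul_conj_apply _ _ _
  rw [Complex.ofReal_pow, ← Complex.mul_conj']
  nth_rewrite 1 2 [subgroupKernel]
  rw [map_sum, Finset.sum_mul_sum, Finset.sum_comm]
  simp [h]

lemma isFourierSupport_subgroupKernel_sub (z : G) :
    IsFourierSupport (fun y => subgroupKernel H (y - z)) (H : Set (AddChar G ℂ)) := by
  have h := isFourierSupport_sum_addChar (T := (H : Set (AddChar G ℂ)))
    (fun χ : H => (χ : AddChar G ℂ) (-z)) (fun χ => (χ : AddChar G ℂ)) fun χ _ => χ.2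
  convert h using 2 with y
  refine Finset.sum_congr rfl fun χ _ => ?_
  rw [sub_eq_neg_add, AddChar.map_add_eq_mul]

/-- Convolution with the kernel of `H` reproduces the functions with Fourier support `H`. -/
lemma sum_mul_subgroupKernel_sub {F : G → ℂ} (hF : IsFourierSupport F (H : Set (AddChar G ℂ)))
    (y : G) : ∑ z, F z * subgroupKernel H (y - z) = Fintype.card G * F y := by
  have hcard : (Fintype.card G : ℂ) ≠ 0 := Nat.cast_ne_zero.2 Fintype.card_ne_zero
  have h : ∑ χ : H, fourierCoeffAb F χ * (χ : AddChar G ℂ) y = F y := by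
    rw [← sum_fourierCoeffAb_mul_apply F y]
    refine Fintype.sum_of_injective Subtype.val Subtype.val_injective _ _ (fun χ hχ => ?_)
      fun χ => rfl
    rw [Subtype.range_coe] at hχ
    rw [not_not.1 fun h => hχ (hF χ h), zero_mul]
  rw [← h]
  simp only [subgroupKernel, Finset.mul_sum]
  rw [Finset.sum_comm]
  refine Finset.sum_congr rfl fun χ _ => ?_
  rw [← mul_assoc, fourierCoeffAb, mul_inv_cancel_left₀ hcard, Finset.sum_mul]
  refine Finset.sum_congr rfl fun z _ => ?_
  rw [sub_eq_add_neg, AddChar.map_add_eq_mul, AddChar.map_neg_eq_conj]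
  ring

lemma eq_sum_mul_norm_sq_subgroupKernel {F : G → ℝ}
    (hF : IsFourierSupport (fun x => (F x : ℂ)) (H : Set (AddChar G ℂ))) (y : G) :
    F y = ((Fintype.card G : ℝ) * Fintype.card H)⁻¹ *
      ∑ z, F z * ‖subgroupKernel H (y - z)‖ ^ 2 := by
  have hG : (Fintype.card G : ℝ) ≠ 0 := Nat.cast_ne_zero.2 Fintype.card_ne_zero
  have hH : (Fintype.card H : ℝ) ≠ 0 := Nat.cast_ne_zero.2 Fintype.card_ne_zero
  rw [eq_inv_mul_iff_mul_eq₀ (mul_ne_zero hG hH)]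
  apply Complex.ofReal_injective
  rw [Complex.ofReal_sum]
  simp only [Complex.ofReal_mul (F _), norm_sq_subgroupKernel]
  have h := sum_mul_subgroupKernel_sub H hF y
  push_cast
  rw [mul_right_comm, ← h, Finset.sum_mul]
  exact Finset.sum_congr rfl fun z _ => by ring

end SubgroupKernel

theorem theorem1 {G₁ G₂ : Type*} [AddCommGroup G₁] [Fintype G₁] [AddCommGroup G₂] [Fintype G₂]
    (f : G₁ × G₂ → ℝ) (hf : ∀ x, 0 ≤ f x)
    (S₁ : Set (AddChar G₁ ℂ)) (S₂ : Set (AddChar G₂ ℂ))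
    (hS : IsFourierSupport (fun x => (f x : ℂ)) (charSetProd S₁ S₂))
    (Γ₁ : SimpleGraph (AddChar G₁ ℂ)) (hΓ₁ : IsChordalCover Γ₁ (SimpleGraph.mulCayley S₁))
    (T₁ : Set (AddChar G₁ ℂ)) (hT₁ : IsGraphFourierSupport Γ₁ T₁)
    (H : Subgroup (AddChar G₂ ℂ)) (hH : Subgroup.closure S₂ = H) :
    HasFSOSCertificate f (charSetProd T₁ (H : Set (AddChar G₂ ℂ))) ∧
      (charSetProd T₁ (H : Set (AddChar G₂ ℂ))).encard ≤
        T₁.encard * (H : Set (AddChar G₂ ℂ)).encard ∧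
      fsosSparsity f ≤ T₁.encard * (H : Set (AddChar G₂ ℂ)).encard := by
  classical
  subst hH
  have hcert : HasFSOSCertificate f (charSetProd T₁ (Subgroup.closure S₂ : Set _)) := by
    set H := Subgroup.closure S₂
    have hslice : ∀ z : G₂, HasFSOSCertificate (fun x => f (x, z)) T₁ := fun z =>
      hasFSOSCertificate_of_isChordalCover (fun x => hf (x, z)) (hS.slice_left z) hΓ₁ hT₁
    have hsum := (HasFSOSCertificate.sum Finset.univ fun z _ =>
      (hslice z).mul_norm_sq (isFourierSupport_subgroupKernel_sub H z)).const_mul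
        (inv_nonneg.2 (by positivity : (0 : ℝ) ≤ (Fintype.card G₂ : ℝ) * Fintype.card H))
    -- The reproducing formula is applied in the second variable with `p.1` frozen; the slice there
    -- has spectrum in `S₂`, hence in `H`.
    convert hsum using 2 with p
    exact eq_sum_mul_norm_sq_subgroupKernel H (F := fun y => f (p.1, y))
      (fun χ hχ => Subgroup.subset_closure (hS.slice_right p.1 χ hχ)) p.2
  exact ⟨hcert, encard_charSetProd_le _ _,
    (iInf₂_le _ hcert).trans (encard_charSetProd_le _ _)⟩
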